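/- **Theorem.** Let $\Bbbk$ be a field and let $R$ be a $\Bbbk$-algebra that is a Nagata ring, i.e. a Noetherian domain such that every domain $S$ of finite type over $R$ has a module-finite integral closure in every finite extension of its quotient field. *Families.* A graded family of ideals is a sequence $\mathfrak a_\bullet=\{\mathfrak a_i\}_{i\ge 1}$ with $\mathfrak a_p\mathfrak a_q\subseteq\mathfrak a_{p+q}$ for all $p,q\ge 1$; it is a filtration if also $\mathfrak a_i\supseteq\mathfrak a_{i+1}$ for all $i\ge1$. Write $\overline{\mathfrak c}$ for the integral closure of an ideal $\mathfrak c$ and $\overline{\mathfrak b_\bullet}=\{\overline{\mathfrak b_i}\}_{i\ge1}$. For sequences of ideals put, in $[-\infty,\infty]$ with $\sup\emptyset=-\infty$, $$\rho(\mathfrak a_\bullet,\mathfrak b_\bullet)=\sup\{\tfrac sr : s,r\ge1,\ \mathfrak a_s\not\subseteq\mathfrak b_r\},\qquad \widehat\rho(\mathfrak a_\bullet,\mathfrak b_\bullet)=\sup\{\tfrac sr : s,r\ge1,\ \mathfrak a_{st}\not\subseteq\mathfrak b_{rt}\text{ for } t\gg0\}.$$ *Rees packages.* Let $\mathcal B$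 be a $\Bbbk$-basis of $R$. A $\mathcal B$-monomial function is a function $v:R\to\mathbb Z_{\ge0}\cup\{\infty\}$, finite on $\mathcal B$, such that $v(f)$ is the minimum of $v(\mathbf b)$ over the $\mathbf b\in\mathcal B$ occurring in $f$ (and $v(0)=\infty$); it is determined by its values on $\mathcal B$. Let $\mathbf v=(v_1,\dots,v_d)$ be a vector of $\mathcal B$-monomial functions, and let $\Gamma\subseteq\mathbb R^d_{\ge0}$ be a polyhedron with integral vertices, $$\Gamma=\{x : \langle \mathbf h_m,x\rangle\ge c_m\ (1\le m\le r),\ \langle \mathbf g_l,x\rangle\ge0\ (1\le l\le q)\},\qquad \mathbf h_m\in\mathbb Z^d_{\ge0},\ c_m\in\mathbb Z_{>0},\ \mathbf g_l\in\mathbb Z^d.$$ The triple $\mathcal R=(\mathcal B,\mathbf v,\Gamma)$ is a Rees package for an ideal $\mathfrak b$ if, for some such description of $\Gamma$, 1. for every integer $s\ge1$, $\overline{\mathfrak b^s}$ is the $\Bbbk$-span of $\{\mathbf b\in\mathcal B : \mathbf v(\mathbf b)\in s\Gamma\}$, and (the case $s=0$, with $0\cdot\Gamma$ read as the recession cone of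 $\Gamma$) $\mathbf v(\mathbf b)$ lies in the recession cone of $\Gamma$ for every $\mathbf b\in\mathcal B$; 2. for each $m$, the $\mathcal B$-monomial function $V_m$ with $V_m(\mathbf b)=\langle\mathbf h_m,\mathbf v(\mathbf b)\rangle$ for $\mathbf b\in\mathcal B$ is a valuation of $R$. For a graded family $\mathfrak a_\bullet$ put $$V_{\mathcal R}(\mathfrak a_n)=\operatorname{conv}\{\mathbf v(\mathbf b) : \mathbf b\in\mathcal B \text{ occurs in some } f\in\mathfrak a_n\},\qquad \Gamma_{\mathcal R}(\mathfrak a_\bullet)=\overline{\bigcup_{n\ge1}\tfrac1nV_{\mathcal R}(\mathfrak a_n)}.$$ *Claim.* Let $\mathfrak b\subseteq R$ be a nonzero ideal with a Rees package $\mathcal R=(\mathcal B,\mathbf v,\Gamma)$ in which $v_1,\dots,v_d$ are valuations of $R$. Let $\mathfrak a_\bullet$ be a filtration and let $\mathfrak b_\bullet$ be a graded family of nonzero ideals of $R$ that is $\mathfrak b$-equivalent: there is an integer $k\ge1$ with $\mathfrak b_{i+k}\subseteq\mathfrak b^i\subseteq\mathfrak b_i$ for all $i\ge1$. Then $$\widehat\rho(\mathfrak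 a_\bullet,\mathfrak b_\bullet)=\rho(\mathfrak a_\bullet,\overline{\mathfrak b_\bullet})=\widehat\rho(\mathfrak a_\bullet,\overline{\mathfrak b_\bullet})=\sup\{\lambda>0 : \lambda\cdot\Gamma_{\mathcal R}(\mathfrak a_\bullet)\not\subseteq\Gamma\}.$$ -/

import Mathlib

open Filter
open scoped Pointwise Polynomial

/-- A Noetherian domain `R` is a Nagata ring (universally Japanese) if every domain `S` of finite
type over `R` has a module-finite integral closure in every finite extension `L` of its fraction
field. -/
def IsNagataDomain.{u} (R : Type u) [CommRing R] : Prop :=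
  IsNoetherianRing R ∧ IsDomain R ∧
    ∀ (S : Type u) [CommRing S] [IsDomain S] [Algebra R S] [Algebra.FiniteType R S]
      (L : Type u) [Field L] [Algebra S L] [Algebra (FractionRing S) L]
      [IsScalarTower S (FractionRing S) L] [FiniteDimensional (FractionRing S) L],
      Module.Finite S (integralClosure S L)

/-- `x` is integral over the ideal `I`: it satisfies an equation
`x ^ n + a₁ x ^ (n - 1) + ⋯ + aₙ = 0` with `aⱼ ∈ I ^ j`. -/
def IsIntegralOverIdeal {R : Type*} [CommRing R] (I : Ideal R) (x : R) : Prop :=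
  ∃ p : R[X], p.Monic ∧ (∀ i, p.coeff i ∈ I ^ (p.natDegree - i)) ∧ p.eval x = 0

/-- `x` is integral over `I` iff `x T` is integral over the Rees algebra `R[I T]`. Used only to see
that the integral closure of an ideal is an ideal. -/
theorem isIntegralOverIdeal_iff {R : Type*} [CommRing R] (I : Ideal R) (x : R) :
    IsIntegralOverIdeal I x ↔ IsIntegral (reesAlgebra I) (Polynomial.monomial 1 x) := by
  rcases subsingleton_or_nontrivial R with hR | hR
  · exact ⟨fun _ => ⟨1, Polynomial.monic_one, Subsingleton.elim _ _⟩,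
      fun _ => ⟨1, Polynomial.monic_one, fun _ => by
        rw [Subsingleton.elim (Polynomial.coeff _ _) 0]; exact zero_mem _, Subsingleton.elim _ _⟩⟩
  constructor
  · rintro ⟨p, hp, hc, he⟩
    set n := p.natDegree with hn
    refine ⟨∑ i ∈ Finset.range (n + 1), Polynomial.monomial i
      (⟨Polynomial.monomial (n - i) (p.coeff i), reesAlgebra.monomial_mem.2 (hc i)⟩ :
        reesAlgebra I), ?_, ?_⟩
    · refine Polynomial.monic_of_natDegree_le_of_coeff_eq_one n ?_ ?_
      · refine Polynomial.natDegree_sum_le_of_forall_le _ _ fun i hi => ?_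
        exact (Polynomial.natDegree_monomial_le _).trans (by simp at hi; omega)
      · rw [Polynomial.finsetSum_coeff, Finset.sum_eq_single n]
        · rw [Polynomial.coeff_monomial, if_pos rfl]
          apply Subtype.ext
          have : p.coeff n = 1 := hp
          simp [this]
        · intro i _ hi
          rw [Polynomial.coeff_monomial, if_neg hi]
        · simp
    · rw [Polynomial.eval₂_finsetSum]
      have h : ∀ i ∈ Finset.range (n + 1), Polynomial.eval₂ (algebraMap (reesAlgebra I) R[X])
          (Polynomial.monomial 1 x) (Polynomial.monomial i
            (⟨Polynomial.monomial (n - i) (p.coeff i), reesAlgebra.monomial_mem.2 (hc i)⟩ :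
              reesAlgebra I)) = Polynomial.monomial n (p.coeff i * x ^ i) := by
        intro i hi
        have hi' : i ≤ n := by simp at hi; omega
        rw [Polynomial.eval₂_monomial, Polynomial.monomial_pow]
        change Polynomial.monomial (n - i) (p.coeff i) * _ = _
        rw [Polynomial.monomial_mul_monomial, show n - i + 1 * i = n by omega]
      rw [Finset.sum_congr rfl h, ← map_sum, ← Polynomial.eval_eq_sum_range, he, map_zero]
  · rintro ⟨q, hq, he⟩
    set n := q.natDegree with hn
    have hcoeff : ∀ j, (∑ i ∈ Finset.range (n + 1),
        Polynomial.monomial i ((q.coeff i : R[X]).coeff (n - i))).coeff j =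
        if j ≤ n then (q.coeff j : R[X]).coeff (n - j) else 0 := by
      intro j
      simp [Polynomial.coeff_monomial]
    have hn1 : (q.coeff n : R[X]) = 1 := by
      have : q.coeff n = 1 := hq
      rw [this]; rfl
    have hle : (∑ i ∈ Finset.range (n + 1),
        Polynomial.monomial i ((q.coeff i : R[X]).coeff (n - i))).natDegree ≤ n := by
      refine Polynomial.natDegree_le_iff_coeff_eq_zero.2 fun j hj => ?_
      rw [hcoeff, if_neg (by omega)]
    have hone : (∑ i ∈ Finset.range (n + 1),
        Polynomial.monomial i ((q.coeff i : R[X]).coeff (n - i))).coeff n = 1 := by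
      rw [hcoeff, if_pos le_rfl, hn1]; simp
    have hdeg : (∑ i ∈ Finset.range (n + 1),
        Polynomial.monomial i ((q.coeff i : R[X]).coeff (n - i))).natDegree = n :=
      le_antisymm hle (Polynomial.le_natDegree_of_ne_zero (by rw [hone]; exact one_ne_zero))
    refine ⟨_, Polynomial.monic_of_natDegree_le_of_coeff_eq_one n hle hone, fun i => ?_, ?_⟩
    · rw [hdeg, hcoeff]
      split_ifs
      · exact (mem_reesAlgebra_iff I _).1 (q.coeff i).2 _
      · exact zero_mem _
    · have h := congrArg (fun P : R[X] => P.coeff n) he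
      simp only [Polynomial.coeff_zero, Polynomial.eval₂_eq_sum_range,
        Polynomial.finsetSum_coeff] at h
      rw [Polynomial.eval_finsetSum, ← h]
      refine Finset.sum_congr rfl fun i hi => ?_
      have hi' : i ≤ n := by simp at hi; omega
      rw [Polynomial.eval_monomial, Polynomial.monomial_pow, one_mul]
      obtain ⟨m, hm⟩ := Nat.exists_eq_add_of_le' hi'
      rw [hm, Polynomial.coeff_mul_monomial, Nat.add_sub_cancel]
      rfl

/-- The integral closure of the ideal `I` in `R`. -/
def idealClosure {R : Type*} [CommRing R] (I : Ideal R) : Ideal R where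
  carrier := {x | IsIntegralOverIdeal I x}
  zero_mem' := by
    simp only [Set.mem_ofPred_eq, isIntegralOverIdeal_iff, map_zero]
    exact isIntegral_zero
  add_mem' := by
    intro x y hx hy
    simp only [Set.mem_ofPred_eq, isIntegralOverIdeal_iff, map_add] at hx hy ⊢
    exact hx.add hy
  smul_mem' := by
    intro r x hx
    simp only [Set.mem_ofPred_eq, isIntegralOverIdeal_iff] at hx ⊢
    have h : Polynomial.monomial 1 (r • x) =
        algebraMap (reesAlgebra I) R[X] (algebraMap R (reesAlgebra I) r) *
          Polynomial.monomial 1 x := by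
      rw [← IsScalarTower.algebraMap_apply]
      simp [Polynomial.C_mul_monomial]
    rw [h]
    exact isIntegral_algebraMap.mul hx

/-- A graded family of ideals `{aᵢ}` for `i ≥ 1`; the value `a 0` plays no role anywhere. -/
def IsGradedFamily {R : Type*} [CommRing R] (a : ℕ → Ideal R) : Prop :=
  ∀ p q, 1 ≤ p → 1 ≤ q → a p * a q ≤ a (p + q)

/-- A filtration: a graded family that is decreasing. -/
def IsIdealFiltration {R : Type*} [CommRing R] (a : ℕ → Ideal R) : Prop :=
  IsGradedFamily a ∧ ∀ i, 1 ≤ i → a (i + 1) ≤ a i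

/-- The family `b` is `I`-equivalent: for some `k ≥ 1`, `b (i + k) ⊆ I ^ i ⊆ b i` for all
`i ≥ 1`. -/
def IsEquivalentToIdeal {R : Type*} [CommRing R] (b : ℕ → Ideal R) (I : Ideal R) : Prop :=
  ∃ k, 1 ≤ k ∧ ∀ i, 1 ≤ i → b (i + k) ≤ I ^ i ∧ I ^ i ≤ b i

/-- The family of the integral closures of the members of a family. -/
def familyClosure {R : Type*} [CommRing R] (b : ℕ → Ideal R) : ℕ → Ideal R :=
  fun i => idealClosure (b i)

/-- The resurgence of a pair of families, in `[-∞, ∞]` with `sup ∅ = -∞`. -/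
noncomputable def resurgence {R : Type*} [CommRing R] (a b : ℕ → Ideal R) : EReal :=
  sSup {x | ∃ s r : ℕ, 1 ≤ s ∧ 1 ≤ r ∧ ¬ a s ≤ b r ∧ x = (((s : ℝ) / (r : ℝ) : ℝ) : EReal)}

/-- The asymptotic resurgence of a pair of families, in `[-∞, ∞]` with `sup ∅ = -∞`. -/
noncomputable def asymptoticResurgence {R : Type*} [CommRing R] (a b : ℕ → Ideal R) : EReal :=
  sSup {x | ∃ s r : ℕ, 1 ≤ s ∧ 1 ≤ r ∧ (∀ᶠ t in atTop, ¬ a (s * t) ≤ b (r * t)) ∧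
    x = (((s : ℝ) / (r : ℝ) : ℝ) : EReal)}

section ReesPackage

variable {k R Λ : Type*} [Field k] [CommRing R] [Algebra k R]

/-- The `B`-monomial function `R → ℤ_{≥0} ∪ {∞}` with value `w i` at the basis element `B i`: it
sends `f` to the minimum of the `w i` over the basis elements occurring in `f` (and `0` to `∞`). -/
noncomputable def monomialFunction (B : Module.Basis Λ k R) (w : Λ → ℕ) (f : R) : ℕ∞ :=
  (B.repr f).support.inf fun i => (w i : ℕ∞)

/-- The `B`-monomial function with values `w` on the basis is a valuation of `R`. -/
def IsMonomialValuation (B : Module.Basis Λ k R) (w : Λ → ℕ) : Prop :=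
  ∃ ν : AddValuation R ℕ∞, ∀ f, ν f = monomialFunction B w f

/-- The point `(v₁(B i), …, v_d(B i))` of `ℝ^d`. -/
def valueVector {d : ℕ} (v : Fin d → Λ → ℕ) (i : Λ) : Fin d → ℝ :=
  fun j => (v j i : ℝ)

/-- The recession cone of a set in `ℝ^d`. -/
def recessionCone {d : ℕ} (Γ : Set (Fin d → ℝ)) : Set (Fin d → ℝ) :=
  {y | ∀ x ∈ Γ, ∀ t : ℝ, 0 ≤ t → x + t • y ∈ Γ}

/-- `(B, v, Γ)` is a Rees package for `I`. The `B`-monomial functions `v₁, …, v_d` are given by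
their values on the basis. -/
structure IsReesPackage {d : ℕ} (B : Module.Basis Λ k R) (v : Fin d → Λ → ℕ)
    (Γ : Set (Fin d → ℝ)) (I : Ideal R) : Prop where
  /-- `Γ` lies in the nonnegative orthant. -/
  nonneg : ∀ x ∈ Γ, ∀ j, 0 ≤ x j
  /-- The vertices of `Γ` are integral. -/
  vertices_integral : ∀ x ∈ Γ.extremePoints ℝ, ∃ z : Fin d → ℤ, ∀ j, x j = (z j : ℝ)
  /-- `Γ` is a polyhedron, cut out by supporting half-spaces `⟨h m, x⟩ ≥ c m` with `c m > 0` (the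
  non-coordinate ones) and `⟨g l, x⟩ ≥ 0`, where `h m` is a vector of nonnegative integers for
  which the `B`-monomial function `V m = ⟨h m, v⟩` is a valuation of `R`. -/
  exists_supporting : ∃ (r q : ℕ) (h : Fin r → Fin d → ℕ) (c : Fin r → ℕ) (g : Fin q → Fin d → ℤ),
    (∀ m, 0 < c m) ∧
    Γ = {x | (∀ m, (c m : ℝ) ≤ ∑ j, (h m j : ℝ) * x j) ∧ ∀ l, 0 ≤ ∑ j, (g l j : ℝ) * x j} ∧
    ∀ m, IsMonomialValuation B fun i => ∑ j, h m j * v j i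
  /-- For `s ≥ 1` the integral closure of `I ^ s` is spanned by the basis elements whose value
  vector lies in `s Γ`. -/
  closure_pow : ∀ s : ℕ, 1 ≤ s → (idealClosure (I ^ s)).restrictScalars k =
    Submodule.span k (B '' {i | valueVector v i ∈ (s : ℝ) • Γ})
  /-- The same for `s = 0`, where `I ^ 0 = R` and `0 Γ` means the recession cone of `Γ`. -/
  closure_pow_zero : ∀ i, valueVector v i ∈ recessionCone Γ

/-- `V(J)`: the convex hull of the value vectors of the basis elements that occur in elements of
`J`. -/
def valueHull {d : ℕ} (B : Module.Basis Λ k R) (v : Fin d → Λ → ℕ) (J : Ideal R) :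
    Set (Fin d → ℝ) :=
  convexHull ℝ {x | ∃ f ∈ J, ∃ i ∈ (B.repr f).support, x = valueVector v i}

/-- `Γ(a)`: the closure of the union of the sets `(1 / n) V(a n)` over `n ≥ 1`. -/
def familyBody {d : ℕ} (B : Module.Basis Λ k R) (v : Fin d → Λ → ℕ) (a : ℕ → Ideal R) :
    Set (Fin d → ℝ) :=
  closure (⋃ n ∈ {n : ℕ | 1 ≤ n}, (1 / (n : ℝ)) • valueHull B v (a n))

end ReesPackage

/-! ### Valuations and integral closure. -/

section AddValuation

variable {R : Type*} [CommRing R]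

/-! The valuations `V m = ⟨h m, v⟩` cut out the closures: `f` is integral over `I ^ s` iff `V m f ≥
s * c m` for all `m`. The inequalities `g l` drop out because every value vector lies in the
recession cone (`IsReesPackage.exists_valuations`).

Equivalence to `I` puts `f ^ t`, for `f ∈ b r`, in `I ^ (r * t - k)`; dividing values by `t` shows
that `b r` and `I ^ r` have the same closure. Since valuations are multiplicative, one `f ∈ a s`
outside the closure of `b r` yields powers outside at every multiple, so both resurgences agree for
the closures.

The Nagata property bounds the closure of `I ^ (n + K)` by `I ^ n ≤ b n`, and a constant shift of
indices is invisible asymptotically. Finally, as `Γ` is closed and convex, a failure of `t • Γ(a) ⊆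
Γ` already occurs at one value vector, hence at some `f ∈ a p` with `t * V m f < p * c m`; powers of
`f` realise ratios at least `t`. -/

/-- The ideal of the elements of value at least `N`. -/
def AddValuation.geIdeal (ν : AddValuation R ℕ∞) (N : ℕ∞) : Ideal R where
  carrier := {x | N ≤ ν x}
  zero_mem' := by simp
  add_mem' := fun hx hy => ν.map_le_add hx hy
  smul_mem' := fun r x (hx : N ≤ ν x) => by
    change N ≤ ν (r * x)
    rw [ν.map_mul]
    exact hx.trans le_add_self

theorem AddValuation.mem_geIdeal {ν : AddValuation R ℕ∞} {N : ℕ∞} {x : R} :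
    x ∈ ν.geIdeal N ↔ N ≤ ν x := Iff.rfl

theorem AddValuation.pow_le_geIdeal {ν : AddValuation R ℕ∞} {N : ℕ} {J : Ideal R}
    (hJ : J ≤ ν.geIdeal N) (n : ℕ) : J ^ n ≤ ν.geIdeal ((n * N : ℕ) : ℕ∞) := by
  induction n with
  | zero => intro x _; simp [AddValuation.mem_geIdeal]
  | succ n ih =>
    rw [pow_succ, Ideal.mul_le]
    intro x hx y hy
    have h1 := AddValuation.mem_geIdeal.1 (ih hx)
    have h2 := AddValuation.mem_geIdeal.1 (hJ hy)
    rw [AddValuation.mem_geIdeal, ν.map_mul, add_mul, one_mul, Nat.cast_add]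
    exact add_le_add h1 h2

theorem AddValuation.natCast_le_map_pow_iff (ν : AddValuation R ℕ∞) {f : R} {w : ℕ}
    (hw : ν f = w) (N t : ℕ) : (N : ℕ∞) ≤ ν (f ^ t) ↔ N ≤ t * w := by
  rw [ν.map_pow, hw, nsmul_eq_mul]
  exact_mod_cast Iff.rfl

theorem AddValuation.idealClosure_le_geIdeal {ν : AddValuation R ℕ∞} {N : ℕ} {J : Ideal R}
    (hJ : J ≤ ν.geIdeal N) : idealClosure J ≤ ν.geIdeal N := by
  rintro f ⟨p, hp, hc, he⟩
  rw [AddValuation.mem_geIdeal]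
  by_contra! hlt
  obtain ⟨w, hw⟩ := ENat.ne_top_iff_exists.1 hlt.ne_top
  rw [← hw, Nat.cast_lt] at hlt
  set n := p.natDegree
  have hsum : f ^ n = -∑ i ∈ Finset.range n, p.coeff i * f ^ i := by
    rw [Polynomial.eval_eq_sum_range, Finset.sum_range_succ, hp.coeff_natDegree, one_mul] at he
    exact eq_neg_of_add_eq_zero_right he
  -- Each term has value at least `(n - i) * N + i * w`, which exceeds `n * w` because `i < n` and
  -- `w < N`.
  have hle : ((n * w + 1 : ℕ) : ℕ∞) ≤ ν (f ^ n) := by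
    rw [hsum, ν.map_neg]
    refine ν.map_le_sum fun i hi => ?_
    obtain ⟨l, hl⟩ := Nat.exists_eq_add_of_lt (Finset.mem_range.1 hi)
    have h1 : (((n - i) * N : ℕ) : ℕ∞) ≤ ν (p.coeff i) :=
      AddValuation.pow_le_geIdeal hJ _ (hc i)
    have h2 := (ν.natCast_le_map_pow_iff hw.symm (i * w) i).2 le_rfl
    rw [ν.map_mul]
    refine le_trans ?_ (add_le_add h1 h2)
    rw [← Nat.cast_add, Nat.cast_le, show n - i = l + 1 by omega, hl]
    nlinarith [Nat.mul_le_mul_left (l + 1) (Nat.succ_le_of_lt hlt)]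
  have := (ν.natCast_le_map_pow_iff hw.symm _ _).1 hle
  omega

end AddValuation

/-! ### Integral closure of powers and the Rees algebra. -/

section IdealClosure

variable {R : Type*} [CommRing R]

theorem le_idealClosure (J : Ideal R) : J ≤ idealClosure J := fun x hx => by
  nontriviality R
  refine ⟨Polynomial.X - Polynomial.C x, Polynomial.monic_X_sub_C x, fun i => ?_, by simp⟩
  rw [Polynomial.natDegree_X_sub_C]
  rcases i with _ | i
  · simpa using hx
  · simp

theorem idealClosure_mono {J K : Ideal R} (h : J ≤ K) : idealClosure J ≤ idealClosure K := by
  rintro x ⟨p, hp, hc, he⟩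
  exact ⟨p, hp, fun i => Ideal.pow_right_mono h _ (hc i), he⟩

/-- If `x` is integral over `I ^ N`, then `x T ^ N` is integral over the Rees algebra of `I`. -/
theorem isIntegral_monomial_of_mem_idealClosure_pow {I : Ideal R} {N : ℕ} {x : R}
    (hx : x ∈ idealClosure (I ^ N)) :
    IsIntegral (reesAlgebra I) (Polynomial.monomial N x) := by
  have hx' := (isIntegralOverIdeal_iff (I ^ N) x).1 hx
  -- The substitution `T ↦ T ^ N` carries `R[I ^ N T]` into `R[I T]`.
  let φ : R[X] →+* R[X] := (Polynomial.expand R N : R[X] →ₐ[R] R[X])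
  have hφ : ∀ y : reesAlgebra (I ^ N), φ (y : R[X]) ∈ reesAlgebra I := by
    intro y
    rw [(y : R[X]).as_sum_support, map_sum]
    refine Subalgebra.sum_mem _ fun i _ => ?_
    change Polynomial.expand R N _ ∈ _
    rw [Polynomial.expand_monomial]
    refine reesAlgebra.monomial_mem.2 ?_
    rw [mul_comm, pow_mul]
    exact (mem_reesAlgebra_iff _ _).1 y.2 i
  let ψ : reesAlgebra (I ^ N) →+* reesAlgebra I :=
    (φ.comp (algebraMap (reesAlgebra (I ^ N)) R[X])).codRestrict (reesAlgebra I) hφ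
  have h := IsIntegral.map_of_comp_eq ψ φ (by ext1 y; rfl) hx'
  have e : φ (Polynomial.monomial 1 x) = Polynomial.monomial N x := by
    change Polynomial.expand R N _ = _
    rw [Polynomial.expand_monomial, one_mul]
  rwa [e] at h

end IdealClosure

/-- The polynomial ring and the Rees algebra of a nonzero ideal have the same quotient field. -/
theorem isFractionRing_reesAlgebra {R : Type*} [CommRing R] [IsDomain R] {I : Ideal R}
    (hI : I ≠ ⊥) (K : Type*) [Field K] [Algebra R[X] K] [IsFractionRing R[X] K] :
    IsFractionRing (reesAlgebra I) K := by
  have hinj : Function.Injective (algebraMap (reesAlgebra I) K) := by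
    rw [IsScalarTower.algebraMap_eq (reesAlgebra I) R[X] K]
    exact (IsFractionRing.injective R[X] K).comp Subtype.val_injective
  have : FaithfulSMul (reesAlgebra I) K := (faithfulSMul_iff_algebraMap_injective _ _).2 hinj
  obtain ⟨a, haI, ha0⟩ := Submodule.exists_mem_ne_zero_of_ne_bot hI
  -- A power of `a ∈ I` pushes every coefficient deep enough into the powers of `I`.
  have hmem : ∀ p : R[X], Polynomial.C (a ^ p.natDegree) * p ∈ reesAlgebra I := fun p => by
    rw [mem_reesAlgebra_iff]
    intro i
    rw [Polynomial.coeff_C_mul]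
    rcases le_or_gt i p.natDegree with hi | hi
    · exact Ideal.mul_mem_right _ _ (Ideal.pow_le_pow_right hi (Ideal.pow_mem_pow haI _))
    · rw [Polynomial.coeff_eq_zero_of_natDegree_lt hi, mul_zero]
      exact zero_mem _
  have hC : ∀ c : R, Polynomial.C c ∈ reesAlgebra I := fun c => (reesAlgebra I).algebraMap_mem c
  refine IsFractionRing.of_field _ _ fun z => ?_
  obtain ⟨p, q, hq, rfl⟩ := IsFractionRing.div_surjective (A := R[X]) z
  have ha : ∀ n, algebraMap R[X] K (Polynomial.C (a ^ n)) ≠ 0 := fun n => by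
    rw [Ne, FaithfulSMul.algebraMap_eq_zero_iff, Polynomial.C_eq_zero]
    exact pow_ne_zero _ ha0
  refine ⟨⟨_, (reesAlgebra I).mul_mem (hC (a ^ q.natDegree)) (hmem p)⟩,
    ⟨_, (reesAlgebra I).mul_mem (hC (a ^ p.natDegree)) (hmem q)⟩, ?_⟩
  rw [IsScalarTower.algebraMap_apply (reesAlgebra I) R[X] K,
    IsScalarTower.algebraMap_apply (reesAlgebra I) R[X] K]
  have hq0 : algebraMap R[X] K q ≠ 0 :=
    IsFractionRing.to_map_ne_zero_of_mem_nonZeroDivisors hq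
  change _ = algebraMap R[X] K (Polynomial.C (a ^ q.natDegree) * (Polynomial.C _ * p)) /
    algebraMap R[X] K (Polynomial.C (a ^ p.natDegree) * (Polynomial.C _ * q))
  rw [map_mul, map_mul, map_mul, map_mul]
  have h1 := ha p.natDegree
  have h2 := ha q.natDegree
  field_simp

/-- Over a Nagata domain the integral closures of the powers of a nonzero ideal are uniformly close
to the powers. -/
theorem IsNagataDomain.exists_idealClosure_pow_add_le {R : Type*} [CommRing R]
    (hR : IsNagataDomain R) {I : Ideal R} (hI : I ≠ ⊥) :
    ∃ K : ℕ, ∀ n, idealClosure (I ^ (n + K)) ≤ I ^ n := by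
  obtain ⟨hN, hD, hfin⟩ := hR
  let S := reesAlgebra I
  let L := FractionRing R[X]
  have : Algebra.FiniteType R S := inferInstance
  have : IsFractionRing S L := isFractionRing_reesAlgebra hI L
  have h := hfin S (FractionRing S)
  have hSN : IsNoetherianRing S := inferInstance
  let M := Subalgebra.toSubmodule (integralClosure S R[X])
  let e : FractionRing S ≃ₐ[S] L := FractionRing.algEquiv S L
  let φ : R[X] →ₐ[S] FractionRing S :=
    (e.symm : L →ₐ[S] FractionRing S).comp (IsScalarTower.toAlgHom S R[X] L)
  have hφ : Function.Injective φ := e.symm.injective.comp (IsFractionRing.injective R[X] L)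
  -- The closure in `R[T]` embeds in the closure in the fraction field, which is finite over the
  -- Noetherian ring `S`.
  let F : M →ₗ[S] Subalgebra.toSubmodule (integralClosure S (FractionRing S)) :=
    (φ.toLinearMap.comp M.subtype).codRestrict _ fun x => IsIntegral.map φ x.2
  have hF : Function.Injective F := fun x y hxy =>
    Subtype.ext (hφ (congrArg Subtype.val hxy))
  have hM : M.FG := by
    rw [← Module.Finite.iff_fg]
    exact Module.Finite.of_injective F hF
  obtain ⟨G, hG⟩ := hM
  -- With generators of degree at most `K`, the coefficient of `T ^ (n + K)` only involves
  -- coefficients from `S` in degrees at least `n`, which lie in `I ^ n`.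
  refine ⟨G.sup Polynomial.natDegree, fun n x hx => ?_⟩
  set K := G.sup Polynomial.natDegree
  have hxM : Polynomial.monomial (n + K) x ∈ M :=
    isIntegral_monomial_of_mem_idealClosure_pow hx
  rw [← hG, Submodule.mem_span_finset] at hxM
  obtain ⟨s, -, hs⟩ := hxM
  have hcoeff := congrArg (fun p : R[X] => p.coeff (n + K)) hs
  simp only [Polynomial.coeff_monomial, if_true, Polynomial.finsetSum_coeff] at hcoeff
  rw [← hcoeff]
  refine Submodule.sum_mem _ fun g hg => ?_
  change ((s g : R[X]) * g).coeff (n + K) ∈ _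
  rw [Polynomial.coeff_mul]
  refine Submodule.sum_mem _ fun ij hij => ?_
  have hij := Finset.HasAntidiagonal.mem_antidiagonal.1 hij
  rcases le_or_gt ij.2 K with hK | hK
  · exact Ideal.mul_mem_right _ _ (Ideal.pow_le_pow_right (by omega)
      ((mem_reesAlgebra_iff I _).1 (s g).2 ij.1))
  · rw [Polynomial.coeff_eq_zero_of_natDegree_lt ((Finset.le_sup hg).trans_lt hK), mul_zero]
    exact zero_mem _

/-! ### Rees packages and equivalent families. -/

section ReesPackage

variable {k R Λ : Type*} [Field k] [CommRing R] [Algebra k R]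

/-- The valuative description of a Rees package: its defining half-spaces of positive height are
given by valuations, which cut out the integral closures of the powers of the ideal. -/
theorem IsReesPackage.exists_valuations {d : ℕ} {B : Module.Basis Λ k R} {v : Fin d → Λ → ℕ}
    {Γ : Set (Fin d → ℝ)} {I : Ideal R} (hRees : IsReesPackage B v Γ I) (hI : I ≠ ⊥) :
    IsClosed Γ ∧ Convex ℝ Γ ∧ ∃ (n : ℕ) (w : Fin n → Λ → ℕ) (c : Fin n → ℕ)
      (ν : Fin n → AddValuation R ℕ∞),
      (∀ m, 0 < c m) ∧ (∀ m f, ν m f = monomialFunction B (w m) f) ∧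
      (∀ (t : ℝ), 0 ≤ t → ∀ i, t • valueVector v i ∈ Γ ↔ ∀ m, (c m : ℝ) ≤ t * w m i) ∧
      ∀ s : ℕ, 1 ≤ s → ∀ f, f ∈ idealClosure (I ^ s) ↔
        ∀ i ∈ (B.repr f).support, (s : ℝ)⁻¹ • valueVector v i ∈ Γ := by
  obtain ⟨r, q, h, c, g, hc, hΓ, hV⟩ := hRees.exists_supporting
  have hmem : ∀ s : ℕ, 1 ≤ s → ∀ f, f ∈ idealClosure (I ^ s) ↔
      ∀ i ∈ (B.repr f).support, (s : ℝ)⁻¹ • valueVector v i ∈ Γ := by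
    intro s hs f
    have hs0 : (s : ℝ) ≠ 0 := by positivity
    have h1 : f ∈ idealClosure (I ^ s) ↔ f ∈ (idealClosure (I ^ s)).restrictScalars k := Iff.rfl
    rw [h1, hRees.closure_pow s hs, Module.Basis.mem_span_image]
    simp only [Set.subset_def, Finset.mem_coe, Set.mem_ofPred_eq,
      Set.mem_smul_set_iff_inv_smul_mem₀ hs0]
  have hne : Γ.Nonempty := by
    by_contra hemp
    rw [Set.not_nonempty_iff_eq_empty] at hemp
    refine hI (eq_bot_iff.2 fun x hx => ?_)
    have hx' := (hmem 1 le_rfl x).1 (le_idealClosure _ (by simpa using hx))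
    rw [hemp] at hx'
    have : (B.repr x).support = ∅ := Finset.eq_empty_of_forall_notMem fun i hi => hx' i hi
    simpa using this
  choose ν hν using hV
  have hlin : ∀ (u : Fin d → ℝ), IsLinearMap ℝ fun x : Fin d → ℝ => ∑ j, u j * x j := fun u =>
    { map_add := fun x y => by simp [mul_add, Finset.sum_add_distrib]
      map_smul := fun t x => by
        simp only [Pi.smul_apply, smul_eq_mul, Finset.mul_sum]
        exact Finset.sum_congr rfl fun j _ => by ring }
  have hcone : ∀ i l, 0 ≤ ∑ j, (g l j : ℝ) * valueVector v i j := by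
    intro i l
    obtain ⟨x, hx⟩ := hne
    by_contra! hlt
    set y := ∑ j, (g l j : ℝ) * valueVector v i j
    have hx0 : 0 ≤ ∑ j, (g l j : ℝ) * x j := (hΓ ▸ hx : x ∈ {x | _}).2 l
    set z := ∑ j, (g l j : ℝ) * x j
    -- Moving this far from `x` along the value vector would bring the functional from `z` down to
    -- `-1`.
    have ht : 0 ≤ (z + 1) / -y := by apply div_nonneg <;> linarith
    have hmem' := hRees.closure_pow_zero i x hx _ ht
    rw [hΓ] at hmem'
    have h0 := hmem'.2 l
    rw [(hlin _).map_add, (hlin _).map_smul, smul_eq_mul] at h0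
    change 0 ≤ z + (z + 1) / -y * y at h0
    have : (z + 1) / -y * y = -(z + 1) := by
      rw [div_neg, neg_mul, div_mul_cancel₀ _ hlt.ne]
    linarith
  refine ⟨?_, ?_, r, fun m i => ∑ j, h m j * v j i, c, ν, hc, hν, ?_, hmem⟩
  · rw [hΓ, Set.ofPred_and, Set.ofPred_forall, Set.ofPred_forall]
    exact (isClosed_iInter fun m => isClosed_le (by fun_prop) (by fun_prop)).inter
      (isClosed_iInter fun l => isClosed_le (by fun_prop) (by fun_prop))
  · rw [hΓ, Set.ofPred_and, Set.ofPred_forall, Set.ofPred_forall]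
    exact (convex_iInter fun m => convex_halfSpace_ge (hlin _) _).inter
      (convex_iInter fun l => convex_halfSpace_ge (hlin _) _)
  · intro t ht i
    have e : ∀ m, ∑ j, (h m j : ℝ) * (t • valueVector v i) j =
        t * ((∑ j, h m j * v j i : ℕ) : ℝ) := fun m => by
      rw [(hlin _).map_smul, smul_eq_mul]
      push_cast
      rfl
    rw [hΓ]
    constructor
    · intro hx m
      rw [← e m]
      exact hx.1 m
    · intro hx
      refine ⟨fun m => (hx m).trans_eq (e m).symm, fun l => ?_⟩
      rw [(hlin _).map_smul]
      exact mul_nonneg ht (hcone i l)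

theorem IsGradedFamily.pow_mem {a : ℕ → Ideal R} (ha : IsGradedFamily a) {s : ℕ} (hs : 1 ≤ s)
    {f : R} (hf : f ∈ a s) {t : ℕ} (ht : 1 ≤ t) : f ^ t ∈ a (s * t) := by
  induction t, ht using Nat.le_induction with
  | base => simpa using hf
  | succ t ht ih =>
    rw [pow_succ, mul_add, mul_one]
    exact ha _ _ (Nat.mul_pos hs ht) hs (Ideal.mul_mem_mul ih hf)

/-- A family equivalent to `I` has the same integral closures as the powers of `I`, once these are
cut out by valuations. -/
theorem familyClosure_eq_of_isEquivalentToIdeal {ι : Type*} {I : Ideal R} {b : ℕ → Ideal R}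
    (hb : IsGradedFamily b) (hbI : IsEquivalentToIdeal b I) {c : ι → ℕ}
    {ν : ι → AddValuation R ℕ∞}
    (hC : ∀ s, 1 ≤ s → ∀ f, f ∈ idealClosure (I ^ s) ↔ ∀ m, ((s * c m : ℕ) : ℕ∞) ≤ ν m f)
    {r : ℕ} (hr : 1 ≤ r) : familyClosure b r = idealClosure (I ^ r) := by
  obtain ⟨K, hK, hbK⟩ := hbI
  refine le_antisymm (fun f hf => (hC r hr f).2 fun m => ?_) (idealClosure_mono (hbK r hr).2)
  refine AddValuation.idealClosure_le_geIdeal (J := b r) (fun f hf => ?_) hf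
  rw [AddValuation.mem_geIdeal]
  by_contra! hlt
  obtain ⟨w, hw⟩ := ENat.ne_top_iff_exists.1 hlt.ne_top
  rw [← hw, Nat.cast_lt] at hlt
  -- compare values at the exponent `K * c m + K + 1`
  set t := K * c m + K
  -- Each factor of `f ^ (t + 1)` falls short by at least `1`, a total deficit `t + 1 > K * c m`,
  -- more than the shift by `K` can absorb.
  obtain ⟨u, hu⟩ : ∃ u, r * (t + 1) = u + 1 + K :=
    ⟨r * (t + 1) - 1 - K, by have := Nat.mul_le_mul_right (t + 1) hr; omega⟩
  have h1 := (hbK (u + 1) (by omega)).1 (hu ▸ hb.pow_mem hr hf (Nat.le_add_left 1 t))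
  have h2 := (hC _ (by omega) _).1 (le_idealClosure _ h1) m
  rw [(ν m).natCast_le_map_pow_iff hw.symm] at h2
  have h3 := Nat.mul_le_mul_left (t + 1) (Nat.succ_le_of_lt hlt)
  have h4 : (t + 1) * (r * c m) = (u + 1) * c m + K * c m := by
    rw [← add_mul, ← hu]; ring
  rw [Nat.mul_succ, h4] at h3
  omega

/-! ### Comparison of resurgences. -/

theorem asymptoticResurgence_le_resurgence (a b : ℕ → Ideal R) :
    asymptoticResurgence a b ≤ resurgence a b := by
  refine sSup_le_sSup ?_
  rintro x ⟨s, r, hs, hr, hev, rfl⟩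
  obtain ⟨t, ht, ht1⟩ := (hev.and (eventually_ge_atTop 1)).exists
  refine ⟨s * t, r * t, Nat.mul_pos hs ht1, Nat.mul_pos hr ht1, ht, ?_⟩
  have : (t : ℝ) ≠ 0 := by positivity
  push_cast
  rw [mul_div_mul_right _ _ this]

theorem asymptoticResurgence_anti {a b b' : ℕ → Ideal R} (h : ∀ i, 1 ≤ i → b i ≤ b' i) :
    asymptoticResurgence a b' ≤ asymptoticResurgence a b := by
  refine sSup_le_sSup ?_
  rintro x ⟨s, r, hs, hr, hev, rfl⟩
  refine ⟨s, r, hs, hr, ?_, rfl⟩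
  filter_upwards [hev, eventually_ge_atTop 1] with t ht ht1 hle
  exact ht (hle.trans (h _ (Nat.mul_pos hr ht1)))

/-- Non-containment in `b (r * t)` passes to `b' (r * t + K)`, and the ratios `s * t / (r * t + K)`
tend to `s / r`. -/
theorem asymptoticResurgence_le_resurgence_of_shift {a b b' : ℕ → Ideal R} (K : ℕ)
    (h : ∀ i, 1 ≤ i → b' (i + K) ≤ b i) : asymptoticResurgence a b ≤ resurgence a b' := by
  refine sSup_le ?_
  rintro x ⟨s, r, hs, hr, hev, rfl⟩
  have hlim : Tendsto (fun t : ℕ => (s : ℝ) / (r + K / t)) atTop (nhds ((s : ℝ) / r)) := by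
    have h0 := (tendsto_const_div_atTop_nhds_zero_nat (K : ℝ)).const_add (r : ℝ)
    rw [add_zero] at h0
    exact tendsto_const_nhds.div h0 (by positivity)
  refine le_of_tendsto ((continuous_coe_real_ereal.tendsto _).comp hlim) ?_
  filter_upwards [hev, eventually_ge_atTop 1] with t ht ht1
  refine le_sSup ⟨s * t, r * t + K, Nat.mul_pos hs ht1, by have := Nat.mul_pos hr ht1; omega,
    fun hle => ht (hle.trans (h _ (Nat.mul_pos hr ht1))), ?_⟩
  have : (t : ℝ) ≠ 0 := by positivity
  simp only [Function.comp_apply]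
  congr 1
  push_cast
  field_simp

end ReesPackage

/-! ### The main theorem. -/

theorem theorem3p8 {k R Λ : Type*} [Field k] [CommRing R] [Algebra k R]
    (hR : IsNagataDomain R)
    {d : ℕ} (B : Module.Basis Λ k R) (v : Fin d → Λ → ℕ) (Γ : Set (Fin d → ℝ))
    (I : Ideal R) (hI : I ≠ ⊥)
    (hRees : IsReesPackage B v Γ I)
    (hv : ∀ j, IsMonomialValuation B (v j))
    (a b : ℕ → Ideal R)
    (ha : IsIdealFiltration a)
    (hb : IsGradedFamily b) (hb0 : ∀ i, 1 ≤ i → b i ≠ ⊥)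
    (hbI : IsEquivalentToIdeal b I) :
    asymptoticResurgence a b = resurgence a (familyClosure b) ∧
    resurgence a (familyClosure b) = asymptoticResurgence a (familyClosure b) ∧
    asymptoticResurgence a (familyClosure b) =
      sSup {x : EReal | ∃ t : ℝ, 0 < t ∧ ¬ t • familyBody B v a ⊆ Γ ∧ x = (t : EReal)} := by
  obtain ⟨hclosed, hconvex, n, w, c, ν, hc, hν, hΓ, hmem⟩ := hRees.exists_valuations hI
  have hνle : ∀ m f (N : ℕ), (N : ℕ∞) ≤ ν m f ↔ ∀ i ∈ (B.repr f).support, N ≤ w m i := by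
    intro m f N
    rw [hν, monomialFunction, Finset.le_inf_iff]
    simp only [Nat.cast_le]
  have hC : ∀ s, 1 ≤ s → ∀ f, f ∈ idealClosure (I ^ s) ↔
      ∀ m, ((s * c m : ℕ) : ℕ∞) ≤ ν m f := by
    intro s hs f
    have hs0 : (0 : ℝ) < s := by positivity
    rw [hmem s hs]
    simp only [hνle]
    have key : ∀ i, (s : ℝ)⁻¹ • valueVector v i ∈ Γ ↔ ∀ m, s * c m ≤ w m i := fun i => by
      rw [hΓ _ (by positivity)]
      refine forall_congr' fun m => ?_
      rw [inv_mul_eq_div, le_div_iff₀ hs0, mul_comm]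
      exact_mod_cast Iff.rfl
    simp only [key]
    exact ⟨fun h m i hi => h i hi m, fun h i hi m => h m i hi⟩
  have hbC : ∀ r, 1 ≤ r → familyClosure b r = idealClosure (I ^ r) := fun r hr =>
    familyClosure_eq_of_isEquivalentToIdeal hb hbI hC hr
  have hres : asymptoticResurgence a (familyClosure b) = resurgence a (familyClosure b) := by
    refine le_antisymm (asymptoticResurgence_le_resurgence _ _) (sSup_le_sSup ?_)
    rintro x ⟨s, r, hs, hr, hnot, rfl⟩
    refine ⟨s, r, hs, hr, ?_, rfl⟩
    obtain ⟨f, hf, hfn⟩ := SetLike.not_le_iff_exists.1 hnot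
    rw [hbC r hr, hC r hr] at hfn
    push Not at hfn
    obtain ⟨m, hm⟩ := hfn
    obtain ⟨u, hu⟩ := ENat.ne_top_iff_exists.1 hm.ne_top
    rw [← hu, Nat.cast_lt] at hm
    filter_upwards [eventually_ge_atTop 1] with t ht hle
    have h1 := hle (ha.1.pow_mem hs hf ht)
    rw [hbC _ (Nat.mul_pos hr ht), hC _ (Nat.mul_pos hr ht)] at h1
    have h2 := ((ν m).natCast_le_map_pow_iff hu.symm _ _).1 (h1 m)
    have h3 := Nat.mul_lt_mul_of_pos_left hm ht
    have h4 : r * t * c m = t * (r * c m) := by ring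
    omega
  refine ⟨?_, hres.symm, ?_⟩
  · refine le_antisymm ?_ (hres ▸ asymptoticResurgence_anti fun i _ => le_idealClosure _)
    obtain ⟨K, hK⟩ := hR.exists_idealClosure_pow_add_le hI
    obtain ⟨_, -, hbk⟩ := hbI
    refine asymptoticResurgence_le_resurgence_of_shift K fun i hi => ?_
    rw [hbC _ (by omega)]
    exact (hK i).trans (hbk i hi).2
  rw [hres]
  refine le_antisymm (sSup_le_sSup ?_) (sSup_le ?_)
  · rintro x ⟨s, r, hs, hr, hnot, rfl⟩
    have hs0 : (0 : ℝ) < s := by positivity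
    have hr0 : (0 : ℝ) < r := by positivity
    refine ⟨s / r, by positivity, fun hsub => ?_, rfl⟩
    refine hnot fun f hf => ?_
    rw [hbC r hr, hmem r hr]
    intro i hi
    have h1 : (1 / (s : ℝ)) • valueVector v i ∈ familyBody B v a :=
      subset_closure (Set.mem_biUnion (show s ∈ {n : ℕ | 1 ≤ n} from hs)
        (Set.smul_mem_smul_set (subset_convexHull ℝ _ ⟨f, hf, i, hi, rfl⟩)))
    have h2 := hsub (Set.smul_mem_smul_set h1)
    rw [smul_smul] at h2
    convert h2 using 2
    field_simp
  · rintro x ⟨t, ht, hnot, rfl⟩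
    -- some basis element occurring in the family violates one of the inequalities
    obtain ⟨p, hp, f, hf, i, hi, hfi⟩ : ∃ p, 1 ≤ p ∧ ∃ f ∈ a p, ∃ i ∈ (B.repr f).support,
        (t * (1 / (p : ℝ))) • valueVector v i ∉ Γ := by
      by_contra! hall
      refine hnot ?_
      rw [Set.smul_set_subset_iff₀ ht.ne']
      refine closure_minimal (Set.iUnion₂_subset fun p hp => ?_)
        (hclosed.smul_of_ne_zero (inv_ne_zero ht.ne'))
      have hp0 : (0 : ℝ) < p := by have : 1 ≤ p := hp; positivity
      rw [← Set.smul_set_subset_iff₀ ht.ne', smul_smul,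
        Set.smul_set_subset_iff₀ (by positivity)]
      refine convexHull_min ?_ (hconvex.smul _)
      rintro _ ⟨f, hf, i, hi, rfl⟩
      rw [Set.mem_inv_smul_set_iff₀ (by positivity)]
      exact hall p hp f hf i hi
    have hp0 : (0 : ℝ) < p := by positivity
    rw [hΓ _ (by positivity)] at hfi
    push Not at hfi
    obtain ⟨m, hm⟩ := hfi
    -- The basis element need not lie in `a p`; its violation passes to `f`, whose value is a
    -- minimum.
    have hle : ν m f ≤ w m i := by
      rw [hν]; exact Finset.inf_le hi
    obtain ⟨u, hu⟩ := ENat.ne_top_iff_exists.1 (hle.trans_lt (ENat.natCast_lt_top _)).ne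
    rw [← hu, Nat.cast_le] at hle
    have hum : t * u < p * c m := by
      have h1 : t * (1 / (p : ℝ)) * u ≤ t * (1 / (p : ℝ)) * w m i := by gcongr
      have h2 := h1.trans_lt hm
      rw [mul_one_div, div_mul_eq_mul_div, div_lt_iff₀ hp0] at h2
      linarith
    -- So large that `t * (N * u + c m) < p * N * c m`: the rounding error in `r` below is then
    -- harmless.
    obtain ⟨N, hN⟩ := exists_nat_gt (t * c m / (p * c m - t * u))
    rw [div_lt_iff₀ (by linarith)] at hN
    have hcm : (0 : ℝ) < c m := by exact_mod_cast hc m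
    have hN1 : 1 ≤ N := by
      rcases Nat.eq_zero_or_pos N with rfl | h
      · rw [Nat.cast_zero, zero_mul] at hN
        exact absurd hN (by have := mul_pos ht hcm; linarith)
      · exact h
    -- The least `r` with `N * u < r * c m`, so `f ^ N` is not in the closure of `b r`.
    set r := N * u / c m + 1
    have hr : 1 ≤ r := Nat.succ_pos _
    have hr0 : (0 : ℝ) < r := by positivity
    have hlow : N * u < r * c m := by
      rw [mul_comm r]; exact Nat.lt_mul_div_succ _ (hc m)
    have hup : r * c m ≤ N * u + c m := by
      rw [add_mul, one_mul]; exact Nat.add_le_add_right (Nat.div_mul_le_self _ _) _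
    have hup' : (r : ℝ) * c m ≤ N * u + c m := by exact_mod_cast hup
    refine le_trans ?_ (le_sSup ⟨p * N, r, Nat.mul_pos hp hN1, hr, fun hsub => ?_, rfl⟩)
    · rw [EReal.coe_le_coe_iff, le_div_iff₀ hr0]
      push_cast
      refine le_of_mul_le_mul_right ?_ hcm
      nlinarith [mul_le_mul_of_nonneg_left hup' ht.le]
    · have h1 := hsub (ha.1.pow_mem hp hf hN1)
      rw [hbC r hr, hC r hr] at h1
      have h2 := ((ν m).natCast_le_map_pow_iff hu.symm _ _).1 (h1 m)
      omega
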